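/- Let $p>q>1$ be coprime integers, and let $D=\{0,1,\dots,pq-1\}$. For $a,b\in D$ write $a=a_1q+a_0$, $b=b_1q+b_0$ with $0\le a_0,b_0<q$ and $0\le a_1,b_1<p$, and put $g(a,b)=a_0p+b_1\in D$. Let $\mathrm{Mul}_{p/q,pq}:D^{\mathbb Z}\to D^{\mathbb Z}$ be the (reversible) cellular automaton $$\mathrm{Mul}_{p/q,pq}(x)[i]=g\bigl(g(x[i-1],x[i]),\,g(x[i],x[i+1])\bigr),\qquad i\in\mathbb Z,$$ which multiplies by $p/q$ in base $pq$: if $x$ has finitely many nonzero digits and represents the number $\sum_{i\in\mathbb Z}x[-i](pq)^i=\xi$, then $\mathrm{Mul}_{p/q,pq}(x)$ represents $\frac pq\,\xi$. Its trace subshift is $$\Xi_{p/q}=\bigl\{\,\bigl(\mathrm{Mul}_{p/q,pq}^{\,t}(x)[0]\bigr)_{t\in\mathbb Z} : x\in D^{\mathbb Z}\,\bigr\}\subseteq D^{\mathbb Z}.$$ A subshift is called sofic if the language of all finite words occurring in its elements is regular. A cellular automaton $F:A^{\mathbb Z}\to A^{\mathbb Z}$ is called regular (in K\r{u}rka's classification)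 if every subshift factor of it is sofic, i.e. every subshift $Y\subseteq B^{\mathbb Z}$ over a finite alphabet $B$ (with at least two letters) for which there is a continuous surjection $\psi:A^{\mathbb Z}\to Y$ with $\psi\circ F=\sigma\circ\psi$, where $\sigma(y)[i]=y[i+1]$. Then the subshift $\Xi_{p/q}$ is not sofic. In particular, the cellular automaton $\mathrm{Mul}_{p/q,pq}$ is not regular, i.e. it has a subshift factor that is not sofic. -/

import Mathlib

namespace MulCA

open SymbolicDynamics.FullShift

/-- The language of a set `S` of bi-infinite sequences: all finite words
`x[i] x[i+1] ⋯ x[i+n-1]` with `x ∈ S`, `i ∈ ℤ`, `n ∈ ℕ`. -/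
def wordsOf {A : Type*} (S : Set (ℤ → A)) : Language A :=
  {w | ∃ x ∈ S, ∃ (i : ℤ) (n : ℕ), w = List.ofFn (fun k : Fin n => x (i + (k : ℕ)))}

/-- A subshift is sofic if its language is regular (recognized by a finite automaton). -/
def IsSofic {A : Type*} [TopologicalSpace A] (Y : Subshift A ℤ) : Prop :=
  (wordsOf Y.carrier).IsRegular

/-- The subshift `Y` (with the shift map `σ(y)[i] = y[i+1]`) is a factor of `(X, T)`: there is a
continuous surjection `ψ` of `X` onto `Y` with `ψ ∘ T = σ ∘ ψ`. -/
def IsSubshiftFactor {X : Type*} [TopologicalSpace X] (T : X → X)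
    {B : Type*} [TopologicalSpace B] (Y : Subshift B ℤ) : Prop :=
  ∃ ψ : X → ℤ → B, Continuous ψ ∧ Set.range ψ = Y.carrier ∧
    ∀ x, ψ (T x) = shift (1 : ℤ) (ψ x)

/-- `(X, T)` is regular if all its subshift factors, over any alphabet (a finite discrete set with
at least two letters), are sofic. -/
def IsRegular {X : Type*} [TopologicalSpace X] (T : X → X) : Prop :=
  ∀ (B : Type) [Finite B] [Nontrivial B] [TopologicalSpace B] [DiscreteTopology B]
    (Y : Subshift B ℤ), IsSubshiftFactor T Y → IsSofic Y

/-- `F` is a cellular automaton on the full shift `A^ℤ`: for some memory `m` and anticipation `a`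
with `m ≤ a` and some local rule `f`, `F(x)[i] = f(x[i+m], …, x[i+a])`. -/
def IsCellularAutomaton {A : Type*} (F : (ℤ → A) → (ℤ → A)) : Prop :=
  ∃ (m a : ℤ) (f : (Set.Icc m a → A) → A), m ≤ a ∧
    ∀ (x : ℤ → A) (i : ℤ), F x i = f (fun j => x (i + (j : ℤ)))

/-- A reversible (that is, bijective) cellular automaton on the full shift `A^ℤ`. -/
structure ReversibleCA (A : Type*) where
  perm : Equiv.Perm (ℤ → A)
  isCA : IsCellularAutomaton perm

/-- The trace of `x` at the origin: the sequence `t ↦ F^t(x)[0]`, `t ∈ ℤ`. -/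
def ReversibleCA.trace {A : Type*} (F : ReversibleCA A) (x : ℤ → A) : ℤ → A :=
  fun t => (F.perm ^ t) x 0

theorem IsCellularAutomaton.continuous {A : Type*} [Finite A] [TopologicalSpace A]
    [DiscreteTopology A] {F : (ℤ → A) → (ℤ → A)} (hF : IsCellularAutomaton F) :
    Continuous F := by
  obtain ⟨m, a, f, -, hf⟩ := hF
  refine continuous_pi fun i => ?_
  have h : (fun x => F x i) = f ∘ (fun x (j : Set.Icc m a) => x (i + (j : ℤ))) := by
    funext x
    exact hf x i
  rw [h]
  exact continuous_of_discreteTopology.comp (by fun_prop)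

theorem ReversibleCA.continuous_zpow {A : Type*} [Finite A] [TopologicalSpace A]
    [DiscreteTopology A] (F : ReversibleCA A) (t : ℤ) :
    Continuous (F.perm ^ t : Equiv.Perm (ℤ → A)) := by
  have h1 : Continuous F.perm := F.isCA.continuous
  have h2 : Continuous (F.perm⁻¹ : Equiv.Perm (ℤ → A)) :=
    (h1.homeoOfEquivCompactToT2 (f := F.perm)).symm.continuous
  have key : ∀ (G : Equiv.Perm (ℤ → A)), Continuous G → ∀ n : ℕ,
      Continuous (G ^ n : Equiv.Perm (ℤ → A)) := by
    intro G hG n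
    rw [Equiv.Perm.coe_pow]
    exact hG.iterate n
  obtain ⟨n, rfl | rfl⟩ := t.eq_nat_or_neg
  · rw [zpow_natCast]
    exact key _ h1 n
  · rw [zpow_neg, zpow_natCast, ← inv_pow]
    exact key _ h2 n

theorem ReversibleCA.trace_zpow {A : Type*} (F : ReversibleCA A) (g : ℤ) (x : ℤ → A) :
    F.trace ((F.perm ^ g) x) = shift g (F.trace x) := by
  funext t
  simp only [ReversibleCA.trace, shift_apply]
  rw [← Equiv.Perm.mul_apply, ← zpow_add, add_comm]

/-- The trace subshift of `F`: the set of all traces `tr_F(x)`, `x ∈ A^ℤ`. -/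
def ReversibleCA.traceSubshift {A : Type*} [Finite A] [TopologicalSpace A] [DiscreteTopology A]
    (F : ReversibleCA A) : Subshift A ℤ where
  carrier := Set.range F.trace
  isClosed := by
    have h : Continuous F.trace :=
      continuous_pi fun t => (continuous_apply (0 : ℤ)).comp (F.continuous_zpow t)
    exact (isCompact_range h).isClosed
  mapsTo := by
    rintro g _ ⟨x, rfl⟩
    exact ⟨(F.perm ^ g) x, F.trace_zpow g x⟩

/-- The local rule of multiplication by `p` in base `n = p q`: writing `a = a₁ q + a₀` and
`b = b₁ q + b₀` with `0 ≤ a₀, b₀ < q`, the value is `a₀ p + b₁`. -/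
def mulDigit {n p q : ℕ} (h : p * q = n) (a b : Fin n) : Fin n :=
  ⟨(a : ℕ) % q * p + (b : ℕ) / q, by
    have hn : 0 < p * q := h ▸ (Nat.zero_le _).trans_lt a.2
    have hq : 0 < q := Nat.pos_of_mul_pos_left hn
    have h1 : (a : ℕ) % q + 1 ≤ q := Nat.mod_lt _ hq
    have h2 : (b : ℕ) / q < p := by
      rw [Nat.div_lt_iff_lt_mul hq, h]
      exact b.2
    calc (a : ℕ) % q * p + (b : ℕ) / q < (a : ℕ) % q * p + p := by omega
      _ = ((a : ℕ) % q + 1) * p := by ring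
      _ ≤ q * p := Nat.mul_le_mul_right _ h1
      _ = n := by rw [mul_comm, h]⟩

/-- The local rule of multiplication by `p / q` in base `n = p q`. -/
def fracDigit {n p q : ℕ} (h : p * q = n) (a b c : Fin n) : Fin n :=
  mulDigit h (mulDigit h a b) (mulDigit h b c)

/-- Multiplication by `p / q` in base `n = p q`, as a map on `{0, …, n-1}^ℤ`. -/
def fracMap {n p q : ℕ} (h : p * q = n) (x : ℤ → Fin n) : ℤ → Fin n :=
  fun i => fracDigit h (x (i - 1)) (x i) (x (i + 1))

theorem mulDigit_mulDigit {n p q : ℕ} (h : p * q = n) (h' : q * p = n) (a b c : Fin n) :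
    mulDigit h' (mulDigit h a b) (mulDigit h b c) = b := by
  have hn : 0 < p * q := h ▸ (Nat.zero_le _).trans_lt a.2
  have hq : 0 < q := Nat.pos_of_mul_pos_left hn
  have hp : 0 < p := Nat.pos_of_mul_pos_right hn
  have hb : (b : ℕ) / q < p := by
    rw [Nat.div_lt_iff_lt_mul hq, h]
    exact b.2
  have hc : (c : ℕ) / q < p := by
    rw [Nat.div_lt_iff_lt_mul hq, h]
    exact c.2
  apply Fin.ext
  change ((a : ℕ) % q * p + (b : ℕ) / q) % p * q + ((b : ℕ) % q * p + (c : ℕ) / q) / p = b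
  rw [add_comm ((a : ℕ) % q * p), Nat.add_mul_mod_self_right, Nat.mod_eq_of_lt hb,
    add_comm ((b : ℕ) % q * p), Nat.add_mul_div_right _ _ hp, Nat.div_eq_of_lt hc, zero_add]
  exact Nat.div_add_mod' _ _

theorem fracMap_fracMap {n p q : ℕ} (h : p * q = n) (h' : q * p = n) (x : ℤ → Fin n) :
    fracMap h' (fracMap h x) = x := by
  funext i
  simp only [fracMap, fracDigit, sub_add_cancel, add_sub_cancel_right, mulDigit_mulDigit h h']

/-- The automaton `Mul_{p/q,pq}` on `{0, …, pq-1}^ℤ`; its inverse is `Mul_{q/p,pq}`. -/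
def fracMul (p q : ℕ) : ReversibleCA (Fin (p * q)) where
  perm :=
    { toFun := fracMap rfl
      invFun := fracMap (mul_comm q p)
      left_inv := fracMap_fracMap rfl (mul_comm q p)
      right_inv := fracMap_fracMap (mul_comm q p) rfl }
  isCA := ⟨-1, 1, fun u => fracDigit rfl (u ⟨-1, by simp⟩) (u ⟨0, by simp⟩) (u ⟨1, by simp⟩),
    by norm_num, fun x i => by simp [fracMap, sub_eq_add_neg]⟩

/-- The number `∑ x[-i] n^i` (`i ∈ ℤ`) represented in base `n` by `x`. -/
noncomputable def realValue {n : ℕ} (x : ℤ → Fin n) : ℝ :=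
  ∑' i : ℤ, ((x (-i) : ℕ) : ℝ) * (n : ℝ) ^ i

/-- A configuration is finite if it has finitely many nonzero digits. -/
def IsFiniteConfig {n : ℕ} (x : ℤ → Fin n) : Prop :=
  {i : ℤ | (x i : ℕ) ≠ 0}.Finite

/-- `F` is a cellular automaton that multiplies by `α` in base `n`: every finite configuration
representing `ξ` is sent to a configuration representing `α ξ`. -/
def MultipliesBy {n : ℕ} (α : ℝ) (F : (ℤ → Fin n) → (ℤ → Fin n)) : Prop :=
  IsCellularAutomaton F ∧ ∀ x, IsFiniteConfig x → realValue (F x) = α * realValue x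

theorem IsFiniteConfig.summable {n : ℕ} {x : ℤ → Fin n} (hx : IsFiniteConfig x)
    (g : ℕ → ℝ) (hg : g 0 = 0) (c : ℤ → ℝ) (j : ℤ) :
    Summable (fun i : ℤ => g (x (j - i)) * c i) := by
  apply summable_of_hasFiniteSupport
  refine (hx.image (fun i => j - i)).subset ?_
  intro i hi
  refine ⟨j - i, ?_, by simp⟩
  intro h0
  apply hi
  simp [h0, hg]

theorem IsFiniteConfig.mulDigit {n p q : ℕ} (h : p * q = n) {x : ℤ → Fin n}
    (hx : IsFiniteConfig x) :
    IsFiniteConfig (fun i => mulDigit h (x i) (x (i + 1))) := by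
  refine (hx.union (hx.image (fun i => i - 1))).subset ?_
  intro i hi
  by_contra hcon
  simp only [Set.mem_union, Set.mem_image, Set.mem_ofPred_eq, not_or, not_not] at hcon
  have h1 : (x (i + 1) : ℕ) = 0 := by
    by_contra h2
    exact hcon.2 ⟨i + 1, h2, by ring⟩
  apply hi
  simp [MulCA.mulDigit, hcon.1, h1]

theorem realValue_mulDigit {n p q : ℕ} (hn : 0 < n) (h : p * q = n) {x : ℤ → Fin n}
    (hx : IsFiniteConfig x) :
    realValue (fun i => mulDigit h (x i) (x (i + 1))) = p * realValue x := by
  have hn' : (n : ℝ) ≠ 0 := by positivity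
  have s0 := hx.summable (fun d => ((d % q : ℕ) : ℝ) * p) (by simp) (fun i => (n : ℝ) ^ i) 0
  have s1 := hx.summable (fun d => ((d / q : ℕ) : ℝ)) (by simp) (fun i => (n : ℝ) ^ i) 1
  have s2 := hx.summable (fun d => ((d / q : ℕ) : ℝ)) (by simp)
    (fun i => (n : ℝ) ^ (i + 1)) 0
  have hs : ∑' i : ℤ, ((x (1 - i) / q : ℕ) : ℝ) * (n : ℝ) ^ i
      = ∑' i : ℤ, ((x (0 - i) / q : ℕ) : ℝ) * (n : ℝ) ^ (i + 1) := by
    rw [← (Equiv.addRight (1 : ℤ)).tsum_eq]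
    refine tsum_congr fun i => ?_
    simp only [Equiv.coe_addRight]
    rw [show (1 : ℤ) - (i + 1) = 0 - i by ring]
  unfold realValue
  calc _ = ∑' i : ℤ, (((x (0 - i) % q : ℕ) : ℝ) * p * (n : ℝ) ^ i
        + ((x (1 - i) / q : ℕ) : ℝ) * (n : ℝ) ^ i) := by
        refine tsum_congr fun i => ?_
        rw [show (1 : ℤ) - i = -i + 1 by ring, show (0 : ℤ) - i = -i by ring]
        simp only [mulDigit]
        push_cast
        ring
    _ = ∑' i : ℤ, (((x (0 - i) % q : ℕ) : ℝ) * p * (n : ℝ) ^ i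
        + ((x (0 - i) / q : ℕ) : ℝ) * (n : ℝ) ^ (i + 1)) := by
        rw [s0.tsum_add s1, s0.tsum_add s2, hs]
    _ = ∑' i : ℤ, (p : ℝ) * (((x (-i) : ℕ) : ℝ) * (n : ℝ) ^ i) := by
        refine tsum_congr fun i => ?_
        rw [zero_sub, zpow_add_one₀ hn']
        have hd : ((x (-i) : ℕ) : ℝ) = ((x (-i) / q : ℕ) : ℝ) * q + ((x (-i) % q : ℕ) : ℝ) := by
          exact_mod_cast (Nat.div_add_mod' (x (-i) : ℕ) q).symm
        have hpq : (n : ℝ) = p * q := by exact_mod_cast h.symm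
        generalize (n : ℝ) ^ i = N
        rw [hd, hpq]
        ring
    _ = _ := tsum_mul_left

theorem realValue_shift {n : ℕ} (hn : 0 < n) (x : ℤ → Fin n) :
    realValue (fun i => x (i - 1)) = (n : ℝ)⁻¹ * realValue x := by
  have hn' : (n : ℝ) ≠ 0 := by positivity
  unfold realValue
  rw [← tsum_mul_left, ← (Equiv.addRight (1 : ℤ)).tsum_eq
    (fun i : ℤ => (n : ℝ)⁻¹ * (((x (-i) : ℕ) : ℝ) * (n : ℝ) ^ i))]
  refine tsum_congr fun i => ?_
  simp only [Equiv.coe_addRight]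
  rw [zpow_add_one₀ hn', show -i - 1 = -(i + 1) by ring]
  field_simp

/-- The automaton `Mul_{p/q,pq}` multiplies by `p / q` in base `p q`. -/
theorem fracMul_multipliesBy (p q : ℕ) (hp : 0 < p) (hq : 0 < q) :
    MultipliesBy ((p : ℝ) / q) (fracMul p q).perm := by
  refine ⟨(fracMul p q).isCA, fun x hx => ?_⟩
  have hn : 0 < p * q := Nat.mul_pos hp hq
  have hx1 := hx.mulDigit (p := p) (q := q) rfl
  have e : realValue ((fracMul p q).perm x) = ((p * q : ℕ) : ℝ)⁻¹ *
      realValue (fun j => mulDigit (p := p) (q := q) rfl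
        (mulDigit (p := p) (q := q) rfl (x j) (x (j + 1)))
        (mulDigit (p := p) (q := q) rfl (x (j + 1)) (x (j + 1 + 1)))) := by
    rw [← realValue_shift hn]
    congr 1
    funext i
    simp [fracMul, fracMap, fracDigit]
  rw [e, realValue_mulDigit hn rfl hx1, realValue_mulDigit hn rfl hx]
  have hp' : (p : ℝ) ≠ 0 := by positivity
  have hq' : (q : ℝ) ≠ 0 := by positivity
  push_cast
  field_simp

end MulCA

/-!
Multiplication by `p` and by `q` in base `n = pq` are one-sided automata `M_p`, `M_q`, and
`F = Mul_{p/q,pq}` satisfies `M_q ∘ F = M_p`. Let `R x ∈ [0,1]` be the value of the digits of `x`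
strictly to the right of the origin. Comparing both sides of `M_q (F x) = M_p x` gives

  `q * R (F x) = p * R x - a`,  `a = q * (F x [0] % p) - p * (x[0] % q)`,

so the increment `a` is read off the trace. Hence if the traces of `x` and `y` agree on `0, …, m`,
then `q ^ m * (R (F^m y) - R (F^m x)) = p ^ m * (R y - R x)`
(`pow_mul_fractionalValue_sub`): differences of fractional values expand by `p / q > 1`.

Let `e` be the configuration of the number `1`, with `R e = 0`, and put `f_t = R (F^t e)`. The
number `q ^ t * f_t` is an integer and, since `p` and `q` are coprime, not divisible by `q` for
`t ≥ 1`; so the `f_t` with `t ≥ 1` are pairwise distinct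
(`fractionalValue_unitConfig_injective`). Suppose the language of the trace subshift were regular,
let `c` be the trace of `e` and `w_k = c_0 ⋯ c_k`. By the pigeonhole principle there are `j ≠ k`
with `c_j = c_k` such that `w_j` and `w_k` have the same continuations; say `f_j < f_k`. Every word
`c_{j+1} ⋯ c_{j+m}` continues `w_j`, so it continues `w_k`, as the trace of some `y`. Since
`R y ≥ 0 = R e`, reading `w_k` gives `R (F^k y) ≥ f_k`. After the continuation, the fractional
values of `F^k y` and `F^j e` are at distance at least `(p / q) ^ m * (f_k - f_j)`. As fractional
values lie in `[0,1]`, this is impossible for large `m`.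

The trace map itself exhibits the trace subshift as a factor of `F`, so `F` is not regular.
-/

namespace MulCA

/-! ### The fractional value and its behaviour under multiplication -/

/-- The number `∑_{i ≥ 1} x[i] n^{-i}` in `[0, 1]` represented by the digits of `x` to the right of
the origin. Expansions ending in the digit `n - 1` are allowed, so the value `1` is possible. -/
noncomputable def fractionalValue {n : ℕ} (x : ℤ → Fin n) : ℝ :=
  Real.ofDigits (fun i : ℕ => x (i + 1))

theorem fractionalValue_nonneg {n : ℕ} (x : ℤ → Fin n) : 0 ≤ fractionalValue x :=
  Real.ofDigits_nonneg _

theorem fractionalValue_le_one {n : ℕ} (x : ℤ → Fin n) : fractionalValue x ≤ 1 :=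
  Real.ofDigits_le_one _

/-- Multiplication by `p` moves the carry `x[1] / q` across the origin. -/
theorem fractionalValue_mulDigit {n p q : ℕ} (h : p * q = n) (x : ℤ → Fin n) :
    fractionalValue (fun i => mulDigit h (x i) (x (i + 1))) =
      p * fractionalValue x - ((x 1 / q : ℕ) : ℝ) := by
  have hn : 0 < n := Fin.pos (x 0)
  have hn' : (n : ℝ) ≠ 0 := by positivity
  have hpq : (n : ℝ) = p * q := by exact_mod_cast h.symm
  -- the sequence of carries, as a sequence of digits in base `n`
  let D : ℕ → Fin n := fun i => ⟨x (i + 1) / q, (Nat.div_le_self _ _).trans_lt (x (i + 1)).2⟩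
  have hD : (n : ℝ) * Real.ofDigits D =
      ((x 1 / q : ℕ) : ℝ) + Real.ofDigits (fun i => D (i + 1)) := by
    rw [Real.ofDigits_eq_sum_add_ofDigits D 1]
    simp only [Finset.range_one, Finset.sum_singleton, Real.ofDigitsTerm, D]
    push_cast
    field_simp
  have key : Real.ofDigits (fun i : ℕ => mulDigit h (x (i + 1)) (x (i + 1 + 1)))
      + n * Real.ofDigits D =
      p * Real.ofDigits (fun i : ℕ => x (i + 1)) + Real.ofDigits (fun i => D (i + 1)) := by
    unfold Real.ofDigits
    rw [← tsum_mul_left, ← tsum_mul_left,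
      ← Real.summable_ofDigitsTerm.tsum_add (Real.summable_ofDigitsTerm.mul_left _),
      ← (Real.summable_ofDigitsTerm.mul_left _).tsum_add Real.summable_ofDigitsTerm]
    refine tsum_congr fun i => ?_
    simp only [Real.ofDigitsTerm, mulDigit, D]
    have hd : ((x (i + 1) : ℕ) : ℝ) =
        ((x (i + 1) / q : ℕ) : ℝ) * q + ((x (i + 1) % q : ℕ) : ℝ) := by
      exact_mod_cast (Nat.div_add_mod' (x (i + 1) : ℕ) q).symm
    rw [hd]
    push_cast
    generalize ((n : ℝ) ^ (i + 1))⁻¹ = N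
    rw [hpq]
    ring
  unfold fractionalValue
  linarith

theorem mulDigit_fracMul (p q : ℕ) (x : ℤ → Fin (p * q)) (i : ℤ) :
    mulDigit (mul_comm q p) ((fracMul p q).perm x i) ((fracMul p q).perm x (i + 1)) =
      mulDigit rfl (x i) (x (i + 1)) := by
  simp only [fracMul, Equiv.coe_fn_mk, fracMap, fracDigit, add_sub_cancel_right]
  exact mulDigit_mulDigit rfl (mul_comm q p) _ _ _

/-- The increment `a` in `q R(F x) = p R(x) - a`, as a function of two consecutive trace
symbols. -/
def traceIncrement {p q : ℕ} (c d : Fin (p * q)) : ℤ :=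
  ((d % p : ℕ) : ℤ) * q - ((c % q : ℕ) : ℤ) * p

/-- Applying `q ·` to `F x` and `p ·` to `x` gives the same configuration; the digits at the origin
of that configuration relate the two carries to the trace. -/
theorem fractionalValue_fracMul {p q : ℕ} (x : ℤ → Fin (p * q)) :
    q * fractionalValue ((fracMul p q).perm x) =
      p * fractionalValue x - traceIncrement (x 0) ((fracMul p q).perm x 0) := by
  have h1 := fractionalValue_mulDigit (mul_comm q p) ((fracMul p q).perm x)
  have h2 := fractionalValue_mulDigit rfl x
  simp only [mulDigit_fracMul] at h1
  have h0 := congrArg (fun a : Fin (p * q) => ((a : ℕ) : ℝ)) (mulDigit_fracMul p q x 0)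
  simp only [mulDigit, zero_add] at h0
  push_cast at h0
  simp only [traceIncrement, Int.cast_sub, Int.cast_mul, Int.cast_natCast]
  linarith

theorem fractionalValue_fracMul_pow_succ {p q : ℕ} (x : ℤ → Fin (p * q)) (t : ℕ) :
    q * fractionalValue (((fracMul p q).perm ^ (t + 1)) x) =
      p * fractionalValue (((fracMul p q).perm ^ t) x) -
        traceIncrement ((fracMul p q).trace x t) ((fracMul p q).trace x (t + 1 : ℕ)) := by
  have h := fractionalValue_fracMul (((fracMul p q).perm ^ t) x)
  rw [← Equiv.Perm.mul_apply, ← pow_succ'] at h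
  simpa only [ReversibleCA.trace, zpow_natCast] using h

/-- Along a common trace, the difference of two fractional values expands by `p / q`. -/
theorem pow_mul_fractionalValue_sub {p q : ℕ} {x y : ℤ → Fin (p * q)} {m : ℕ}
    (h : ∀ s ≤ m, (fracMul p q).trace x (s : ℕ) = (fracMul p q).trace y (s : ℕ)) :
    (q : ℝ) ^ m * (fractionalValue (((fracMul p q).perm ^ m) y) -
        fractionalValue (((fracMul p q).perm ^ m) x)) =
      (p : ℝ) ^ m * (fractionalValue y - fractionalValue x) := by
  induction m with
  | zero => simp
  | succ m ih =>
    have ih := ih fun s hs => h s (hs.trans m.le_succ)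
    have hx := fractionalValue_fracMul_pow_succ x m
    have hy := fractionalValue_fracMul_pow_succ y m
    rw [← h m m.le_succ, ← h (m + 1) le_rfl] at hy
    rw [pow_succ (q : ℝ), pow_succ (p : ℝ), mul_assoc, mul_sub, hx, hy]
    linear_combination (p : ℝ) * ih

/-! ### The orbit of the number one -/

/-- The configuration representing the number `1`. -/
def unitConfig {n : ℕ} (hn : 1 < n) : ℤ → Fin n :=
  fun i => if i = 0 then ⟨1, hn⟩ else ⟨0, zero_lt_one.trans hn⟩

theorem fractionalValue_unitConfig {n : ℕ} (hn : 1 < n) :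
    fractionalValue (unitConfig hn) = 0 := by
  have h : ∀ i : ℕ, ((i : ℤ) + 1 = 0) ↔ False := fun i => iff_false_intro (by omega)
  simp [fractionalValue, unitConfig, Real.ofDigits, Real.ofDigitsTerm, h]

/-- For `t ≥ 1` the fractional value after `t` steps has exact denominator `q ^ t`, in the sense
that its numerator is not divisible by `q`. -/
theorem exists_fractionalValue_unitConfig_eq {p q : ℕ} (hq : 1 < q) (hpq : Nat.Coprime p q)
    (hn : 1 < p * q) (t : ℕ) :
    ∃ u : ℤ, ¬ (q : ℤ) ∣ u ∧ (q : ℝ) ^ (t + 1) *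
      fractionalValue (((fracMul p q).perm ^ (t + 1)) (unitConfig hn)) = u := by
  have hcop : IsCoprime (q : ℤ) p := Nat.isCoprime_iff_coprime.mpr hpq.symm
  induction t with
  | zero =>
    refine ⟨-traceIncrement ((fracMul p q).trace (unitConfig hn) (0 : ℕ))
      ((fracMul p q).trace (unitConfig hn) (0 + 1 : ℕ)), ?_, ?_⟩
    · have h0 : (fracMul p q).trace (unitConfig hn) (0 : ℕ) = ⟨1, hn⟩ := by
        simp [ReversibleCA.trace, unitConfig]
      rw [h0, traceIncrement, Nat.mod_eq_of_lt hq, dvd_neg, dvd_sub_right (dvd_mul_left _ _)]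
      intro hd
      have hd' : q ∣ p := by simpa [Int.natCast_dvd_natCast] using hd
      exact hq.ne' (Nat.Coprime.eq_one_of_dvd hpq.symm hd')
    · rw [zero_add, pow_one, show ((fracMul p q).perm ^ 1) = (fracMul p q).perm ^ (0 + 1) from rfl,
        fractionalValue_fracMul_pow_succ]
      simp [fractionalValue_unitConfig]
  | succ t ih =>
    obtain ⟨u, hu, hval⟩ := ih
    refine ⟨u * p - q ^ (t + 1) * traceIncrement ((fracMul p q).trace (unitConfig hn) (t + 1 : ℕ))
      ((fracMul p q).trace (unitConfig hn) (t + 1 + 1 : ℕ)), ?_, ?_⟩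
    · rw [dvd_sub_left (Dvd.dvd.mul_right (dvd_pow_self _ t.succ_ne_zero) _)]
      exact fun hd => hu (hcop.dvd_of_dvd_mul_right hd)
    · rw [pow_succ, mul_assoc, fractionalValue_fracMul_pow_succ, mul_sub, mul_left_comm, hval]
      push_cast
      ring

theorem fractionalValue_unitConfig_injective {p q : ℕ} (hq : 1 < q) (hpq : Nat.Coprime p q)
    (hn : 1 < p * q) : Function.Injective fun t : ℕ =>
      fractionalValue (((fracMul p q).perm ^ (t + 1)) (unitConfig hn)) := by
  refine Function.Injective.of_lt_imp_ne fun j k hjk he => ?_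
  obtain ⟨u, -, hu⟩ := exists_fractionalValue_unitConfig_eq hq hpq hn j
  obtain ⟨v, hv, hv'⟩ := exists_fractionalValue_unitConfig_eq hq hpq hn k
  obtain ⟨d, rfl⟩ := Nat.exists_eq_add_of_lt hjk
  apply hv
  have : (v : ℝ) = ((q ^ (d + 1) * u : ℤ) : ℝ) := by
    rw [← hv', ← he, Int.cast_mul, ← hu]
    push_cast
    ring
  rw [Int.cast_injective this]
  exact Dvd.dvd.mul_right (dvd_pow_self _ d.succ_ne_zero) _

/-! ### Words of the trace subshift -/

theorem mem_wordsOf_range_trace {A : Type*} (F : ReversibleCA A) {w : List A} :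
    w ∈ wordsOf (Set.range F.trace) ↔
      ∃ y, ∀ (s : ℕ) (hs : s < w.length), F.trace y s = w[s] := by
  constructor
  · rintro ⟨_, ⟨x, rfl⟩, i, n, rfl⟩
    refine ⟨(F.perm ^ i) x, fun s hs => ?_⟩
    rw [F.trace_zpow, List.getElem_ofFn, SymbolicDynamics.FullShift.shift_apply, add_comm]
  · rintro ⟨y, hy⟩
    refine ⟨_, ⟨y, rfl⟩, 0, w.length, ?_⟩
    refine List.ext_getElem (by simp) fun s hs _ => ?_
    simp [← hy s hs]

theorem trace_pow {A : Type*} (F : ReversibleCA A) (k s : ℕ) (x : ℤ → A) :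
    F.trace ((F.perm ^ k) x) s = F.trace x (k + s : ℕ) := by
  rw [← zpow_natCast, F.trace_zpow, SymbolicDynamics.FullShift.shift_apply, Nat.cast_add]

/-- Suppose the trace of the number `1` has the same symbol at times `j` and `k`. If its prefix up
to time `k` can be continued by the word of
length `m` that follows time `j`, then the fractional values at times `j` and `k` satisfy
`f_k - f_j ≤ (q / p) ^ m`. -/
theorem pow_mul_sub_le_of_append_mem {p q : ℕ} (hn : 1 < p * q) {j k m : ℕ}
    (hjk : (fracMul p q).trace (unitConfig hn) (j : ℕ) =
      (fracMul p q).trace (unitConfig hn) (k : ℕ))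
    (hw : List.ofFn (fun s : Fin (k + 1) => (fracMul p q).trace (unitConfig hn) (s : ℕ)) ++
      List.ofFn (fun s : Fin m => (fracMul p q).trace (unitConfig hn) (j + 1 + s : ℕ)) ∈
        wordsOf (Set.range (fracMul p q).trace)) :
    (p : ℝ) ^ m * (fractionalValue (((fracMul p q).perm ^ k) (unitConfig hn)) -
      fractionalValue (((fracMul p q).perm ^ j) (unitConfig hn))) ≤ (q : ℝ) ^ m := by
  obtain ⟨y, hy⟩ := (mem_wordsOf_range_trace _).mp hw
  simp only [List.length_append, List.length_ofFn] at hy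
  set e := unitConfig hn
  have h1 : ∀ s ≤ k, (fracMul p q).trace e (s : ℕ) = (fracMul p q).trace y (s : ℕ) := by
    intro s hs
    rw [hy s (by omega), List.getElem_append_left (by simpa using Nat.lt_succ_of_le hs), List.getElem_ofFn]
  have h2 : ∀ s ≤ m, (fracMul p q).trace (((fracMul p q).perm ^ j) e) (s : ℕ) =
      (fracMul p q).trace (((fracMul p q).perm ^ k) y) (s : ℕ) := by
    intro s hs
    rw [trace_pow, trace_pow]
    rcases s with _ | s
    · rw [add_zero, add_zero, hjk, h1 k le_rfl]
    · rw [hy (k + (s + 1)) (by omega), List.getElem_append_right (by simp)]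
      simp only [List.getElem_ofFn, List.length_ofFn]
      congr 2
      omega
  have hp : 0 < p := Nat.pos_of_mul_pos_right (zero_lt_one.trans hn)
  have hq : 0 < q := Nat.pos_of_mul_pos_left (zero_lt_one.trans hn)
  have e1 := pow_mul_fractionalValue_sub h1
  have e2 := pow_mul_fractionalValue_sub h2
  -- the fractional value of `y` starts at or above that of `e`, which is `0`
  have hle : fractionalValue (((fracMul p q).perm ^ k) e) ≤
      fractionalValue (((fracMul p q).perm ^ k) y) := by
    rw [fractionalValue_unitConfig hn, sub_zero] at e1
    have h3 : 0 ≤ (p : ℝ) ^ k * fractionalValue y :=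
      mul_nonneg (by positivity) (fractionalValue_nonneg y)
    rw [← e1] at h3
    exact sub_nonneg.mp (nonneg_of_mul_nonneg_right h3 (by positivity))
  calc _ ≤ (p : ℝ) ^ m * (fractionalValue (((fracMul p q).perm ^ k) y) -
        fractionalValue (((fracMul p q).perm ^ j) e)) := by gcongr
    _ = _ := e2.symm
    _ ≤ (q : ℝ) ^ m * (1 - 0) := by
        gcongr
        · exact fractionalValue_le_one _
        · exact fractionalValue_nonneg _
    _ = _ := by ring

theorem not_isSofic_traceSubshift {p q : ℕ} (hq : 1 < q) (hqp : q < p)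
    (hpq : Nat.Coprime p q) : ¬ IsSofic (fracMul p q).traceSubshift := by
  intro hreg
  have hn : 1 < p * q := one_lt_mul'' (hq.trans hqp) hq
  set c := (fracMul p q).trace (unitConfig hn) with hc
  let L := wordsOf (Set.range (fracMul p q).trace)
  have hfin : (Set.range L.leftQuotient).Finite :=
    Language.IsRegular.finite_range_leftQuotient hreg
  have : Finite (Set.range L.leftQuotient) := hfin
  let w : ℕ → List (Fin (p * q)) := fun k => List.ofFn fun s : Fin (k + 1) => c (s : ℕ)
  -- indices start at `1`, where the fractional values become pairwise distinct
  obtain ⟨j, k, hne, heq⟩ := Finite.exists_ne_map_eq_of_infinite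
    fun t : ℕ => ((⟨L.leftQuotient (w (t + 1)), Set.mem_range_self _⟩, c (t + 1 : ℕ)) :
      Set.range L.leftQuotient × Fin (p * q))
  have heq1 : L.leftQuotient (w (j + 1)) = L.leftQuotient (w (k + 1)) :=
    congrArg Subtype.val (Prod.ext_iff.mp heq).1
  have heq2 : c (j + 1 : ℕ) = c (k + 1 : ℕ) := (Prod.ext_iff.mp heq).2
  have hf := (fractionalValue_unitConfig_injective hq hpq hn).ne hne
  wlog hlt : fractionalValue (((fracMul p q).perm ^ (j + 1)) (unitConfig hn)) <
      fractionalValue (((fracMul p q).perm ^ (k + 1)) (unitConfig hn)) generalizing j k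
  · exact this k j hne.symm heq.symm heq1.symm heq2.symm hf.symm
      (lt_of_le_of_ne (not_lt.mp hlt) hf.symm)
  have hq' : (0 : ℝ) < q := by exact_mod_cast zero_lt_one.trans hq
  have hbound : ∀ m : ℕ, ((p : ℝ) / q) ^ m *
      (fractionalValue (((fracMul p q).perm ^ (k + 1)) (unitConfig hn)) -
        fractionalValue (((fracMul p q).perm ^ (j + 1)) (unitConfig hn))) ≤ 1 := by
    intro m
    let v := List.ofFn fun s : Fin m => c (j + 1 + 1 + s : ℕ)
    have hv : w (j + 1) ++ v ∈ L := by
      refine (mem_wordsOf_range_trace _).mpr ⟨unitConfig hn, fun s hs => ?_⟩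
      rw [List.getElem_append]
      split_ifs with h
      · simp only [w, hc, List.getElem_ofFn]
      · simp only [w, v, List.length_ofFn, List.getElem_ofFn] at h ⊢
        rw [hc, Nat.add_sub_cancel' (not_lt.mp h)]
    have hv' : w (k + 1) ++ v ∈ L := by
      rwa [← Language.mem_leftQuotient, ← heq1, Language.mem_leftQuotient]
    have := pow_mul_sub_le_of_append_mem hn heq2 hv'
    rwa [div_pow, div_mul_eq_mul_div, div_le_one (by positivity)]
  have h1 : 1 < (p : ℝ) / q := by
    rw [one_lt_div hq']
    exact_mod_cast hqp
  obtain ⟨m, hm⟩ := pow_unbounded_of_one_lt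
    (fractionalValue (((fracMul p q).perm ^ (k + 1)) (unitConfig hn)) -
      fractionalValue (((fracMul p q).perm ^ (j + 1)) (unitConfig hn)))⁻¹ h1
  have hpos := sub_pos.mpr hlt
  exact absurd (hbound m) (not_le.mpr ((inv_lt_iff_one_lt_mul₀ hpos).mp hm))

/-- The trace map is a factor map onto the trace subshift. -/
theorem ReversibleCA.isSubshiftFactor_traceSubshift {A : Type*} [Finite A] [TopologicalSpace A]
    [DiscreteTopology A] (F : ReversibleCA A) : IsSubshiftFactor F.perm F.traceSubshift :=
  ⟨F.trace, continuous_pi fun t => (continuous_apply (0 : ℤ)).comp (F.continuous_zpow t), rfl,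
    fun x => by simpa using F.trace_zpow 1 x⟩

end MulCA

theorem mainTheorem3 (p q : ℕ) (hq : 1 < q) (hqp : q < p) (hpq : Nat.Coprime p q) :
    ¬ MulCA.IsSofic (MulCA.fracMul p q).traceSubshift ∧
      ¬ MulCA.IsRegular (MulCA.fracMul p q).perm := by
  have h := MulCA.not_isSofic_traceSubshift hq hqp hpq
  have : Nontrivial (Fin (p * q)) :=
    Fin.nontrivial_iff_two_le.mpr (one_lt_mul'' (hq.trans hqp) hq)
  exact ⟨h, fun hreg => h (hreg _ _ (MulCA.fracMul p q).isSubshiftFactor_traceSubshift)⟩
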